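/- Let $K$ be a field and let $A=K[a_1,\ldots,a_n]$ be a weighted $\mathbb N$-filtered solvable polynomial algebra. That is: the monomials $a^\alpha=a_1^{\alpha_1}\cdots a_n^{\alpha_n}$ ($\alpha\in\mathbb N^n$) form a $K$-basis of $A$; there is a monomial ordering $\prec$ on them such that for all $\alpha,\beta$ one has $a^\alpha a^\beta=\lambda a^{\alpha+\beta}+f$ with $\lambda\in K^*$ and $f=0$ or $\mathrm{LM}(f)\prec a^{\alpha+\beta}$; and, for fixed positive integers $d(a_i)=m_i$ and $d(a^\alpha)=\sum_i m_i\alpha_i$, the subspaces $F_pA=K\text{-span}\{a^\alpha\mid d(a^\alpha)\le p\}$ satisfy $F_pA\,F_qA\subseteq F_{p+q}A$. Here a monomial ordering is a well-ordering $\prec$ of the monomials such that, for all monomials $u,v,w,x$: if $v\prec w$ and $\mathrm{LM}(uvx),\mathrm{LM}(uwx)$ are not constant, then $\mathrm{LM}(uvx)\prec\mathrm{LM}(uwx)$; and if $w=\mathrm{LM}(uvx)\neq v$, then $v\prec w$; where $\mathrm{LM}$ is the $\prec$-largest monomial occurring in a nonzero element. All modules are left modules. Let $M$ be an $A$-module with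 an exhaustive increasing filtration $(F_qM)_{q\in\mathbb N}$ by $K$-subspaces with $F_pA\,F_qM\subseteq F_{p+q}M$; a nonzero $\xi\in M$ has filtered degree $d_{\rm fil}(\xi)=q$ if $\xi\in F_qM\setminus F_{q-1}M$ (with $F_{-1}M=0$). An F-basis of $M$ is a finite set $\{v_1,\ldots,v_k\}$ of nonzero elements of $M$ for which there are $n_1,\ldots,n_k\in\mathbb N$ with $F_qM=\sum_i\bigl(\sum_{p+n_i\le q}F_pA\bigr)v_i$ for all $q$; it is minimal if no proper subset is an F-basis. A submodule $N\subseteq M$ has the induced filtration $F_qN=N\cap F_qM$, and $M/N$ has the filtration $(F_qM+N)/N$; a standard basis of $N$ is an F-basis of $N$ for the induced filtration. A strict filtered isomorphism is an $A$-module isomorphism mapping $F_q$ onto $F_q$ for all $q$. Let $L=\bigoplus_{i=1}^m Ae_i$ be a free module, let $b_1,\ldots,b_m\in\mathbb N$, and filter $L$ by $F_qL=\sum_i\bigl(\sum_{p+b_i\le q}F_pA\bigr)e_i$. Let $N\subseteq L$ be a submodule, $M=L/N$ with the quotient filtration $FM$, and let $U=\{\xi_1,\ldots,\xi_s\}$ be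 a standard basis of $N$. Consider the following algorithm. Start with $E'=\{e_1,\ldots,e_m\}$ and the list $V=(\xi_1,\ldots,\xi_s)$. As long as some member $v_j=\sum_k f_{kj}e_k$ of the list $V$ has, on some $e_i\in E'$, a coefficient $f_{ij}\in K^*$ with $b_i=d_{\rm fil}(v_j)$, choose any such $v_j$ and the least such $i$ for it, replace every other member $v_\ell=\sum_k f_{k\ell}e_k$ by $v_\ell'=v_\ell-\frac1{f_{ij}}f_{i\ell}v_j$, discard $v_j$ and all $v'_\ell=0$, and remove $e_i$ from $E'$. Whatever choices are made, the algorithm stops after finitely many passes. Let $E'=\{e_{i_1},\ldots,e_{i_{m'}}\}$ and $V=\{v_1,\ldots,v_t\}$ be its output, and put $L'=\bigoplus_{k=1}^{m'}Ae_{i_k}$, with the filtration $F_qL'=\sum_k\bigl(\sum_{p+b_{i_k}\le q}F_pA\bigr)e_{i_k}$. Then $V\subseteq N\cap L'$, and with $N'=\sum_{\ell=1}^tAv_\ell\subseteq L'$ the following hold. (i) There is a strict filtered isomorphism $L'/N'\cong M=L/N$, where $L'/N'$ has the quotient filtration $(F_qL'+N')/N'$. (ii) $V$ is a standard basis of $N'$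 with respect to the filtration induced by $FL'$, and, writing $v_\ell=\sum_k h_{k\ell}e_{i_k}$, $h_{k\ell}\in K^*$ implies $b_{i_k}<d_{\rm fil}(v_\ell)$. (iii) The cosets $\overline{e}_{i_1},\ldots,\overline{e}_{i_{m'}}$ in $M$ are pairwise distinct and form a minimal F-basis of $M$ with respect to $FM$. -/

import Mathlib

open Module

noncomputable section

namespace FilteredSolvable

section Algebra

variable {K A : Type*} [Field K] [Ring A] [Algebra K A] {n : ℕ}

/-- The ordered monomial `a^α = a_1^{α_1} ⋯ a_n^{α_n}`. -/
def monomial (a : Fin n → A) (α : Fin n → ℕ) : A :=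
  (List.ofFn fun i => a i ^ α i).prod

/-- With respect to the `K`-basis `B` (indexed by exponent vectors) and the ordering `lt`, the
leading monomial of `f` is the one with exponent vector `γ`. It holds for no `γ` if `f = 0`. -/
def IsLM (B : Basis (Fin n → ℕ) K A) (lt : (Fin n → ℕ) → (Fin n → ℕ) → Prop)
    (f : A) (γ : Fin n → ℕ) : Prop :=
  B.repr f γ ≠ 0 ∧ ∀ β, B.repr f β ≠ 0 → β = γ ∨ lt β γ

/-- `lt` is a monomial ordering on the `K`-basis `B` of `A`; monomials are identified with
their exponent vectors, and the monomial `1` has exponent vector `0`. -/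
structure IsMonomialOrdering (B : Basis (Fin n → ℕ) K A)
    (lt : (Fin n → ℕ) → (Fin n → ℕ) → Prop) : Prop where
  wellOrder : IsWellOrder (Fin n → ℕ) lt
  mul_lt : ∀ γ α β η μ ν : Fin n → ℕ, lt α β →
    IsLM B lt (B γ * B α * B η) μ → IsLM B lt (B γ * B β * B η) ν →
    μ ≠ 0 → ν ≠ 0 → lt μ ν
  lt_of_divides : ∀ α β η γ : Fin n → ℕ, β ≠ γ →
    IsLM B lt (B α * B β * B η) γ → lt β γ

variable (K A n) in
/-- A solvable polynomial algebra structure on the `K`-algebra `A`: generators `a_1, …, a_n`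
whose ordered monomials form a `K`-basis (a PBW basis), and a monomial ordering for which
`a^α a^β = λ a^{α+β} + f` with `λ ≠ 0` and `f = 0` or `LM(f) ≺ a^{α+β}`. -/
structure SolvablePolynomialAlgebra where
  gen : Fin n → A
  pbw : Basis (Fin n → ℕ) K A
  pbw_eq : ∀ α, pbw α = monomial gen α
  lt : (Fin n → ℕ) → (Fin n → ℕ) → Prop
  monomialOrdering : IsMonomialOrdering pbw lt
  mul_eq : ∀ α β : Fin n → ℕ, ∃ (c : K) (f : A), c ≠ 0 ∧
    pbw α * pbw β = c • pbw (α + β) + f ∧ ∀ γ, IsLM pbw lt f γ → lt γ (α + β)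

/-- The weighted degree `m_1 α_1 + ⋯ + m_n α_n` of an exponent vector. -/
def weight (d : Fin n → ℕ) (α : Fin n → ℕ) : ℕ := ∑ i, d i * α i

/-- `F_p A`, the `K`-span of the monomials of weighted degree at most `p`. -/
def algFil (B : Basis (Fin n → ℕ) K A) (d : Fin n → ℕ) (p : ℕ) : Submodule K A :=
  Submodule.span K {x | ∃ α, weight d α ≤ p ∧ x = B α}

variable (K A n) in
/-- A weighted `ℕ`-filtered solvable polynomial algebra: a solvable polynomial algebra with
positive degrees `d(a_i)` such that `F_p A · F_q A ⊆ F_{p+q} A`. -/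
structure WeightedFilteredSolvableAlgebra extends SolvablePolynomialAlgebra K A n where
  deg : Fin n → ℕ
  deg_pos : ∀ i, 0 < deg i
  fil_mul : ∀ p q : ℕ, ∀ f ∈ algFil pbw deg p, ∀ g ∈ algFil pbw deg q,
    f * g ∈ algFil pbw deg (p + q)

/-- The weighted filtration `F_p A`. -/
def WeightedFilteredSolvableAlgebra.fil (S : WeightedFilteredSolvableAlgebra K A n) (p : ℕ) :
    Submodule K A :=
  algFil S.pbw S.deg p

end Algebra

section Modules

variable {K A : Type*} [Field K] [Ring A] [Algebra K A]
variable {M : Type*} [AddCommGroup M] [Module A M] [Module K M] [IsScalarTower K A M]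
variable {M' : Type*} [AddCommGroup M'] [Module A M'] [Module K M'] [IsScalarTower K A M']

/-- For elements `v_i` of a module and natural numbers `b_i`, the filtration
`F_q = ∑_i (∑_{p + b_i ≤ q} F_p A) v_i`. -/
def goodFil (FA : ℕ → Submodule K A) {ι : Type*} (v : ι → M) (b : ι → ℕ) (q : ℕ) :
    Submodule K M :=
  Submodule.span K {x | ∃ i p, p + b i ≤ q ∧ ∃ f ∈ FA p, x = f • v i}

/-- The nonzero element `x` has filtered degree `q`, that is, `x ∈ F_q \ F_{q-1}`
(where `F_{-1} = 0`). -/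
def HasFilDeg (F : ℕ → Submodule K M) (x : M) (q : ℕ) : Prop :=
  x ≠ 0 ∧ x ∈ F q ∧ ∀ p, p < q → x ∉ F p

/-- The filtration `F_q N = N ∩ F_q M` induced on a submodule `N`. -/
def subFil (F : ℕ → Submodule K M) (N : Submodule A M) (q : ℕ) : Submodule K N :=
  (F q).comap (N.subtype.restrictScalars K)

/-- The filtration `F_q (M/N) = (F_q M + N)/N` induced on the quotient by `N`. -/
def quotFil (F : ℕ → Submodule K M) (N : Submodule A M) (q : ℕ) : Submodule K (M ⧸ N) :=
  (F q).map (N.mkQ.restrictScalars K)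

/-- `V` is an F-basis of the filtered module `M`: a finite set of nonzero elements such that,
for suitable `n_v ∈ ℕ`, one has `F_q M = ∑_v (∑_{p + n_v ≤ q} F_p A) v` for all `q`. -/
def IsFBasis (FA : ℕ → Submodule K A) (F : ℕ → Submodule K M) (V : Set M) : Prop :=
  V.Finite ∧ 0 ∉ V ∧ ∃ b : V → ℕ, ∀ q, F q = goodFil FA (fun v : V => (v : M)) b q

/-- An F-basis no proper subset of which is an F-basis. -/
def IsMinimalFBasis (FA : ℕ → Submodule K A) (F : ℕ → Submodule K M) (V : Set M) : Prop :=
  IsFBasis FA F V ∧ ∀ W, W ⊂ V → ¬ IsFBasis FA F W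

/-- `W ⊆ N` is a standard basis of `N`: an F-basis of `N` for the filtration induced by that
of `M`. -/
def IsStandardBasis (FA : ℕ → Submodule K A) (F : ℕ → Submodule K M) (N : Submodule A M)
    (W : Set M) : Prop :=
  W ⊆ N ∧ IsFBasis FA (subFil F N) ((fun x : N => (x : M)) ⁻¹' W)

/-- `φ` is a strict filtered isomorphism: `φ(F_q M) = F_q M'` for all `q`. -/
def IsStrictFilteredIso (F : ℕ → Submodule K M) (F' : ℕ → Submodule K M')
    (φ : M ≃ₗ[A] M') : Prop :=
  ∀ q, φ '' (F q : Set M) = (F' q : Set M')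

end Modules

section Elimination

variable {K A : Type*} [Field K] [Ring A] [Algebra K A] {m : ℕ}

/-- The standard basis vector `e_i` of the free left module `L = A^m`. -/
def e (A : Type*) [Ring A] {m : ℕ} (i : Fin m) : Fin m → A := Pi.single i 1

/-- The filtration on `L = ⊕ A e_i` for which `e_i` has filtered degree `b_i`. -/
def freeFil (FA : ℕ → Submodule K A) (b : Fin m → ℕ) : ℕ → Submodule K (Fin m → A) :=
  goodFil FA (e A) b

/-- The free submodule `L' = ⊕_{i ∈ E} A e_i` of `L`. -/
def partialFree (A : Type*) [Ring A] {m : ℕ} (E : Finset (Fin m)) :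
    Submodule A (Fin m → A) :=
  Submodule.span A (e A '' (E : Set (Fin m)))

/-- The basis vectors `e_i`, `i ∈ E`, as elements of `L' = ⊕_{i ∈ E} A e_i`. -/
def partialE (A : Type*) [Ring A] {m : ℕ} (E : Finset (Fin m)) (i : E) : partialFree A E :=
  ⟨e A (i : Fin m), Submodule.subset_span ⟨i, i.2, rfl⟩⟩

/-- The filtration on `L' = ⊕_{i ∈ E} A e_i` for which `e_i` has filtered degree `b_i`. -/
def partialFil (FA : ℕ → Submodule K A) (b : Fin m → ℕ) (E : Finset (Fin m)) :
    ℕ → Submodule K (partialFree A E) :=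
  goodFil FA (partialE A E) (fun i => b i)

/-- The coefficient of `v` on `e_i` is a nonzero constant `c`, and the term `c e_i` has the
filtered degree of `v`; as `c` has degree `0`, this degree is `b_i`. -/
def IsPivot (FA : ℕ → Submodule K A) (b : Fin m → ℕ) (v : Fin m → A) (i : Fin m) (c : K) :
    Prop :=
  c ≠ 0 ∧ v i = algebraMap K A c ∧ HasFilDeg (freeFil FA b) v (b i)

open Classical in
/-- One pass through the loop, from the state `(E, V)` to the state `(E', V')`. Some `v` in
`V` with a pivot is chosen freely, `i` is the least index in `E` of a pivot of `v`, every other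
member `u` of `V` is replaced by `u - (1/c) u_i v`, zeros are discarded, and `i` is removed
from `E`. The list `v_1, …, v_t` is kept as a multiset, so that its order is immaterial. -/
def Step (FA : ℕ → Submodule K A) (b : Fin m → ℕ)
    (s s' : Finset (Fin m) × Multiset (Fin m → A)) : Prop :=
  ∃ (v : Fin m → A) (T : Multiset (Fin m → A)) (i : Fin m) (c : K),
    s.2 = v ::ₘ T ∧ i ∈ s.1 ∧ IsPivot FA b v i c ∧
    (∀ k ∈ s.1, k < i → ∀ c' : K, ¬ IsPivot FA b v k c') ∧
    s'.1 = s.1.erase i ∧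
    s'.2 = (T.map fun u => u - (c⁻¹ • u i) • v).filter (fun u => u ≠ 0)

/-- The state of the elimination before the first pass: all basis vectors, and the given
list `ξ_1, …, ξ_s`. -/
def initState {s : ℕ} (ξ : Fin s → Fin m → A) : Finset (Fin m) × Multiset (Fin m → A) :=
  (Finset.univ, Finset.univ.val.map ξ)

/-- `(E, V)` is an output of the elimination started with `ξ_1, …, ξ_s`: it is reached after
finitely many passes, and the loop condition fails. -/
def IsOutput (FA : ℕ → Submodule K A) (b : Fin m → ℕ) {s : ℕ} (ξ : Fin s → Fin m → A)
    (E : Finset (Fin m)) (V : Multiset (Fin m → A)) : Prop :=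
  Relation.ReflTransGen (Step FA b) (initState ξ) (E, V) ∧ ∀ s', ¬ Step FA b (E, V) s'

/-- The output list `V` as a subset of `L' = ⊕_{i ∈ E} A e_i`. -/
def outputSet (E : Finset (Fin m)) (V : Multiset (Fin m → A)) : Set (partialFree A E) :=
  {v | (v : Fin m → A) ∈ V}

/-- The submodule `N'` of `L'` generated by the output `V`. -/
def outputSubmodule (E : Finset (Fin m)) (V : Multiset (Fin m → A)) :
    Submodule A (partialFree A E) :=
  Submodule.span A (outputSet E V)

end Elimination

end FilteredSolvable

end

/-! Write `L_E` for the free module on the `e_i`, `i ∈ E`. Two properties survive every pass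
(`IsReduced`): elements of `N ∩ L_E` are combinations of `V` without excess degree, and every
element of `L` is congruent mod `N` to an element of `L_E` of no larger degree. A pass with pivot
`c` of `v` at `i` applies the `A`-linear map `u ↦ u - c⁻¹ u_i v` (`elimMap`). It does not raise
degrees, because `v` has degree `b_i`; it kills `v`, sends `L_E` into `L_{E \ {i}}`, fixes whatever
has no `e_i`-term, and moves elements only by multiples of `v ∈ N`. Hence both properties pass on
(`IsReduced.step`), and (i) and the standard basis in (ii) follow with `N' = N ∩ L_E`.

When no pivot is left, an element of `N ∩ L_E` of degree at most `b_i`, `i ∈ E`, has no `e_i`-term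
(`IsReduced.apply_eq_zero`): the generators that contribute have degree at most `b_i`, so their
`e_i`-coefficient lies in `F_0 A = K`, and a nonzero one would be a pivot. So `e_i` is not congruent
mod `N` to an element of `L_E` of degree at most `b_i` without `e_i`-term (`IsReduced.mkQ_e_ne`),
which yields distinctness and minimality in (iii). -/

namespace FilteredSolvable

/-! ### Filtrations of the algebra with degree-zero part `K` -/

section Filtration

variable {K A : Type*} [Field K] [Ring A] [Algebra K A]

/-- An exhaustive increasing multiplicative filtration of a `K`-algebra with `F_0 A = K`. -/
structure IsConnectedFiltration (FA : ℕ → Submodule K A) : Prop where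
  mono : Monotone FA
  one_mem : (1 : A) ∈ FA 0
  mul_mem : ∀ p q : ℕ, ∀ f ∈ FA p, ∀ g ∈ FA q, f * g ∈ FA (p + q)
  eq_algebraMap : ∀ f ∈ FA 0, ∃ c : K, f = algebraMap K A c
  exhaustive : ∀ f : A, ∃ p, f ∈ FA p

lemma algFil_mono {n : ℕ} (B : Basis (Fin n → ℕ) K A) (d : Fin n → ℕ) :
    Monotone (algFil B d) := by
  intro p q hpq
  refine Submodule.span_mono ?_
  rintro x ⟨α, hα, rfl⟩
  exact ⟨α, hα.trans hpq, rfl⟩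

lemma SolvablePolynomialAlgebra.pbw_zero {n : ℕ} (S : SolvablePolynomialAlgebra K A n) :
    S.pbw 0 = 1 := by
  rw [S.pbw_eq, monomial]
  refine List.prod_eq_one ?_
  intro x hx
  obtain ⟨i, rfl⟩ := (List.mem_ofFn' _ _).1 hx
  simp

lemma WeightedFilteredSolvableAlgebra.isConnectedFiltration {n : ℕ}
    (S : WeightedFilteredSolvableAlgebra K A n) : IsConnectedFiltration S.fil where
  mono := algFil_mono _ _
  one_mem := Submodule.subset_span ⟨0, by simp [weight], S.pbw_zero.symm⟩
  mul_mem := S.fil_mul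
  eq_algebraMap f hf := by
    have hle : S.fil 0 ≤ Submodule.span K {(1 : A)} := by
      refine Submodule.span_le.2 ?_
      rintro x ⟨α, hα, rfl⟩
      -- All degrees are positive, so only the exponent `0` has weight `0`.
      have h0 : α = 0 := by
        funext i
        have h1 : S.deg i * α i ≤ 0 :=
          (Finset.single_le_sum (f := fun i => S.deg i * α i) (fun _ _ => Nat.zero_le _)
            (Finset.mem_univ i)).trans hα
        rcases Nat.mul_eq_zero.1 (Nat.le_zero.1 h1) with h2 | h2
        · exact absurd h2 (S.deg_pos i).ne'
        · exact h2
      rw [h0, S.pbw_zero]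
      exact Submodule.mem_span_singleton_self _
    obtain ⟨c, rfl⟩ := Submodule.mem_span_singleton.1 (hle hf)
    exact ⟨c, (Algebra.algebraMap_eq_smul_one c).symm⟩
  exhaustive f := by
    have hf : f ∈ Submodule.span K (Set.range S.pbw) := by simp [S.pbw.span_eq]
    induction hf using Submodule.span_induction with
    | mem x hx =>
      obtain ⟨α, rfl⟩ := hx
      exact ⟨weight S.deg α, Submodule.subset_span ⟨α, le_rfl, rfl⟩⟩
    | zero => exact ⟨0, zero_mem _⟩
    | add x y _ _ hx hy =>
      obtain ⟨p, hp⟩ := hx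
      obtain ⟨q, hq⟩ := hy
      exact ⟨max p q, add_mem (algFil_mono _ _ (le_max_left p q) hp)
        (algFil_mono _ _ (le_max_right p q) hq)⟩
    | smul c x _ hx =>
      obtain ⟨p, hp⟩ := hx
      exact ⟨p, Submodule.smul_mem _ c hp⟩

lemma SolvablePolynomialAlgebra.nontrivial {n : ℕ} (S : SolvablePolynomialAlgebra K A n) :
    Nontrivial A :=
  ⟨S.pbw 0, 0, S.pbw.ne_zero 0⟩

/-- The filtration of `A` shifted by `k`. -/
def shiftFil (FA : ℕ → Submodule K A) (k q : ℕ) : Submodule K A :=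
  if k ≤ q then FA (q - k) else ⊥

lemma mem_shiftFil_of_le {FA : ℕ → Submodule K A} (hFA : IsConnectedFiltration FA)
    {k p q : ℕ} {f : A} (h : p + k ≤ q) (hf : f ∈ FA p) : f ∈ shiftFil FA k q := by
  rw [shiftFil, if_pos (by omega)]
  exact hFA.mono (by omega) hf

/-- The alternative `f = 0` covers `q < k`, where no `p` exists and truncated subtraction would
wrongly give `FA 0`. -/
lemma mem_shiftFil_iff {FA : ℕ → Submodule K A} (hFA : IsConnectedFiltration FA)
    {k q : ℕ} {f : A} : f ∈ shiftFil FA k q ↔ f = 0 ∨ ∃ p, p + k ≤ q ∧ f ∈ FA p := by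
  constructor
  · intro h
    unfold shiftFil at h
    split_ifs at h with hk
    · exact Or.inr ⟨q - k, by omega, h⟩
    · exact Or.inl ((Submodule.mem_bot K).1 h)
  · rintro (rfl | ⟨p, hp, hf⟩)
    · exact zero_mem _
    · exact mem_shiftFil_of_le hFA hp hf

lemma mul_mem_shiftFil {FA : ℕ → Submodule K A} (hFA : IsConnectedFiltration FA)
    {k p d q : ℕ} {f g : A} (hpq : p + d ≤ q) (hf : f ∈ FA p) (hg : g ∈ shiftFil FA k d) :
    f * g ∈ shiftFil FA k q := by
  rcases (mem_shiftFil_iff hFA).1 hg with rfl | ⟨r, hr, hg⟩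
  · simp
  · exact mem_shiftFil_of_le hFA (p := p + r) (by omega) (hFA.mul_mem _ _ _ hf _ hg)

end Filtration

/-! ### Filtered free modules in coordinates -/

section Free

variable {K A : Type*} [Field K] [Ring A] [Algebra K A] {m : ℕ}
variable {FA : ℕ → Submodule K A} {b : Fin m → ℕ}

lemma smul_e_apply (f : A) (i k : Fin m) : (f • e A i) k = if k = i then f else 0 := by
  by_cases h : k = i
  · subst h; simp [e]
  · simp [e, h]

lemma eq_sum_smul_e (x : Fin m → A) : x = ∑ i, x i • e A i := by
  funext k
  simp [Finset.sum_apply, e, Pi.single_apply]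

/-- Since the `e_i` are free, all degree estimates in `L` reduce to estimates on coefficients. -/
lemma mem_freeFil_iff (hFA : IsConnectedFiltration FA) {q : ℕ} {x : Fin m → A} :
    x ∈ freeFil FA b q ↔ ∀ i, x i ∈ shiftFil FA (b i) q := by
  constructor
  · intro hx i
    have hle : freeFil FA b q ≤ (shiftFil FA (b i) q).comap (LinearMap.proj i) := by
      refine Submodule.span_le.2 ?_
      rintro _ ⟨j, p, hp, f, hf, rfl⟩
      change (f • e A j) i ∈ shiftFil FA (b i) q
      rw [smul_e_apply]
      split_ifs with h
      · subst h; exact mem_shiftFil_of_le hFA hp hf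
      · exact zero_mem _
    exact hle hx
  · intro h
    rw [eq_sum_smul_e x]
    refine Submodule.sum_mem _ fun i _ => ?_
    rcases (mem_shiftFil_iff hFA).1 (h i) with h0 | ⟨p, hp, hf⟩
    · simp [h0]
    · exact Submodule.subset_span ⟨i, p, hp, _, hf, rfl⟩

lemma smul_mem_freeFil (hFA : IsConnectedFiltration FA) {p d q : ℕ} {f : A} {x : Fin m → A}
    (hpq : p + d ≤ q) (hf : f ∈ FA p) (hx : x ∈ freeFil FA b d) :
    f • x ∈ freeFil FA b q := by
  rw [mem_freeFil_iff hFA] at hx ⊢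
  exact fun i => mul_mem_shiftFil hFA hpq hf (hx i)

lemma freeFil_mono (hFA : IsConnectedFiltration FA) : Monotone (freeFil FA b) := by
  intro p q hpq x hx
  simpa using smul_mem_freeFil hFA (p := 0) (by omega) hFA.one_mem hx

lemma smul_e_mem_freeFil {p q : ℕ} {i : Fin m} {f : A} (hp : p + b i ≤ q) (hf : f ∈ FA p) :
    f • e A i ∈ freeFil FA b q :=
  Submodule.subset_span ⟨i, p, hp, f, hf, rfl⟩

lemma e_mem_freeFil (hFA : IsConnectedFiltration FA) {q : ℕ} {i : Fin m} (hi : b i ≤ q) :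
    e A i ∈ freeFil FA b q := by
  simpa using smul_e_mem_freeFil (p := 0) (by omega) hFA.one_mem

lemma freeFil_exhaustive (hFA : IsConnectedFiltration FA) (x : Fin m → A) :
    ∃ q, x ∈ freeFil FA b q := by
  choose p hp using fun i => hFA.exhaustive (x i)
  refine ⟨∑ i, (p i + b i), (mem_freeFil_iff hFA).2 fun i => mem_shiftFil_of_le hFA ?_ (hp i)⟩
  exact Finset.single_le_sum (f := fun i => p i + b i) (fun _ _ => Nat.zero_le _)
    (Finset.mem_univ i)

lemma exists_hasFilDeg (hFA : IsConnectedFiltration FA) {x : Fin m → A} (hx : x ≠ 0) :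
    ∃ q, HasFilDeg (freeFil FA b) x q := by
  classical
  have h := freeFil_exhaustive (b := b) hFA x
  exact ⟨Nat.find h, hx, Nat.find_spec h, fun p hp => Nat.find_min h hp⟩

lemma HasFilDeg.le_of_mem {x : Fin m → A} {q d : ℕ} (h : HasFilDeg (freeFil FA b) x q)
    (hd : x ∈ freeFil FA b d) : q ≤ d :=
  not_lt.1 fun hlt => h.2.2 d hlt hd

lemma mem_partialFree_iff {E : Finset (Fin m)} {x : Fin m → A} :
    x ∈ partialFree A E ↔ ∀ i, i ∉ E → x i = 0 := by
  constructor
  · intro hx i hi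
    have hle : partialFree A E ≤ LinearMap.ker (LinearMap.proj i : (Fin m → A) →ₗ[A] A) := by
      refine Submodule.span_le.2 ?_
      rintro _ ⟨j, hj, rfl⟩
      have hij : i ≠ j := by rintro rfl; exact hi hj
      simp [e, hij]
    exact hle hx
  · intro h
    rw [eq_sum_smul_e x]
    refine Submodule.sum_mem _ fun i _ => ?_
    by_cases hi : i ∈ E
    · exact Submodule.smul_mem _ _ (Submodule.subset_span ⟨i, hi, rfl⟩)
    · simp [h i hi]

lemma e_mem_partialFree {E : Finset (Fin m)} {i : Fin m} (hi : i ∈ E) :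
    e A i ∈ partialFree A E :=
  Submodule.subset_span ⟨i, hi, rfl⟩

/-- The filtration of `L'` is the one induced from `L`, so the arguments can be carried out inside
`L`. -/
lemma mem_partialFil_iff (hFA : IsConnectedFiltration FA) {E : Finset (Fin m)} {q : ℕ}
    {x : partialFree A E} :
    x ∈ partialFil FA b E q ↔ (x : Fin m → A) ∈ freeFil FA b q := by
  constructor
  · intro hx
    have hle : partialFil FA b E q ≤
        (freeFil FA b q).comap ((partialFree A E).subtype.restrictScalars K) := by
      refine Submodule.span_le.2 ?_
      rintro _ ⟨j, p, hp, f, hf, rfl⟩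
      exact smul_e_mem_freeFil hp hf
    exact hle hx
  · intro hx
    have hsum : x = ∑ i : E, (x : Fin m → A) i • partialE A E i := by
      apply Subtype.ext
      rw [AddSubmonoidClass.coe_finsetSum]
      conv_lhs => rw [eq_sum_smul_e (x : Fin m → A)]
      change _ = ∑ i : E, (x : Fin m → A) i • e A (i : Fin m)
      rw [Finset.sum_coe_sort E (fun i => (x : Fin m → A) i • e A i)]
      refine (Finset.sum_subset (Finset.subset_univ E) fun i _ hi => ?_).symm
      rw [mem_partialFree_iff.1 x.2 i hi, zero_smul]
    rw [hsum]
    refine Submodule.sum_mem _ fun i _ => ?_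
    rcases (mem_shiftFil_iff hFA).1 ((mem_freeFil_iff hFA).1 hx i) with h0 | ⟨p, hp, hf⟩
    · simp [h0]
    · exact Submodule.subset_span ⟨i, p, hp, _, hf, rfl⟩

end Free

/-! ### The elimination step, its invariant, and termination -/

section Invariant

variable {K A : Type*} [Field K] [Ring A] [Algebra K A] {m : ℕ}
variable {FA : ℕ → Submodule K A} {b : Fin m → ℕ} {N : Submodule A (Fin m → A)}

/-- The `K`-span of the products `f v` with `v ∈ V` of filtered degree at most `d` and
`f ∈ F_p A`, where `p + d ≤ q`. -/
def degSpan (FA : ℕ → Submodule K A) (b : Fin m → ℕ) (V : Multiset (Fin m → A)) (q : ℕ) :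
    Submodule K (Fin m → A) :=
  Submodule.span K {x | ∃ v ∈ V, ∃ d p, v ∈ freeFil FA b d ∧ p + d ≤ q ∧
    ∃ f ∈ FA p, x = f • v}

/-- The invariant of the elimination: `V` is a standard basis of `N ∩ L_E`, and `L_E → L/N` is
strictly surjective. -/
structure IsReduced (FA : ℕ → Submodule K A) (b : Fin m → ℕ) (N : Submodule A (Fin m → A))
    (E : Finset (Fin m)) (V : Multiset (Fin m → A)) : Prop where
  ne_zero : ∀ v ∈ V, v ≠ 0
  mem : ∀ v ∈ V, v ∈ N ∧ v ∈ partialFree A E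
  mem_degSpan : ∀ q, ∀ x ∈ freeFil FA b q, x ∈ N → x ∈ partialFree A E → x ∈ degSpan FA b V q
  exists_sub_mem : ∀ q, ∀ x ∈ freeFil FA b q,
    ∃ y ∈ freeFil FA b q, y ∈ partialFree A E ∧ x - y ∈ N

/-- The projection along `v` which annihilates the coordinate `i`, if `v i = c`. -/
def elimMap (v : Fin m → A) (i : Fin m) (c : K) : (Fin m → A) →ₗ[A] (Fin m → A) where
  toFun u := u - (c⁻¹ • u i) • v
  map_add' x y := by simp only [Pi.add_apply, smul_add, add_smul]; abel
  map_smul' f x := by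
    simp only [Pi.smul_apply, smul_eq_mul, RingHom.id_apply, smul_sub, smul_smul,
      Algebra.mul_smul_comm]

lemma elimMap_apply (v : Fin m → A) (i : Fin m) (c : K) (u : Fin m → A) :
    elimMap v i c u = u - (c⁻¹ • u i) • v := rfl

lemma elimMap_of_eq_zero {v : Fin m → A} {i : Fin m} {c : K} {u : Fin m → A} (hu : u i = 0) :
    elimMap v i c u = u := by
  simp [elimMap_apply, hu]

lemma elimMap_apply_self {v : Fin m → A} {i : Fin m} {c : K} (hc : c ≠ 0)
    (hv : v i = algebraMap K A c) (u : Fin m → A) : elimMap v i c u i = 0 := by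
  simp only [elimMap_apply, Pi.sub_apply, Pi.smul_apply, smul_eq_mul, hv]
  -- The coordinate is `u_i - c⁻¹ u_i c`; it vanishes because constants are central.
  rw [← Algebra.commutes, ← Algebra.smul_def, smul_inv_smul₀ hc, sub_self]

lemma elimMap_self {v : Fin m → A} {i : Fin m} {c : K} (hc : c ≠ 0)
    (hv : v i = algebraMap K A c) : elimMap v i c v = 0 := by
  rw [elimMap_apply, hv, Algebra.algebraMap_eq_smul_one, inv_smul_smul₀ hc, one_smul, sub_self]

lemma elimMap_mem_freeFil (hFA : IsConnectedFiltration FA) {v : Fin m → A} {i : Fin m} {c : K}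
    (hv : v ∈ freeFil FA b (b i)) {q : ℕ} {u : Fin m → A} (hu : u ∈ freeFil FA b q) :
    elimMap v i c u ∈ freeFil FA b q := by
  rw [elimMap_apply]
  refine sub_mem hu ?_
  rcases (mem_shiftFil_iff hFA).1 ((mem_freeFil_iff hFA).1 hu i) with h0 | ⟨p, hp, hf⟩
  · simp [h0]
  -- The degree of `u_i` is at most `q - b_i`, which exactly offsets the degree bound `b_i` on `v`.
  · exact smul_mem_freeFil hFA hp (Submodule.smul_mem _ _ hf) hv

lemma elimMap_mem_partialFree {v : Fin m → A} {i : Fin m} {c : K} (hc : c ≠ 0)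
    (hv : v i = algebraMap K A c) {E : Finset (Fin m)} (hvE : v ∈ partialFree A E)
    {u : Fin m → A} (hu : u ∈ partialFree A E) :
    elimMap v i c u ∈ partialFree A (E.erase i) := by
  rw [mem_partialFree_iff]
  intro k hk
  by_cases hki : k = i
  · rw [hki, elimMap_apply_self hc hv]
  · have hkE : k ∉ E := fun h => hk (Finset.mem_erase.2 ⟨hki, h⟩)
    rw [elimMap_apply, Pi.sub_apply, Pi.smul_apply, mem_partialFree_iff.1 hu k hkE,
      mem_partialFree_iff.1 hvE k hkE]
    simp

lemma partialFree_mono {E E' : Finset (Fin m)} (h : E ⊆ E') :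
    partialFree A E ≤ partialFree A E' :=
  Submodule.span_mono (Set.image_mono (by exact_mod_cast h))

lemma IsReduced.step (hFA : IsConnectedFiltration FA)
    {s s' : Finset (Fin m) × Multiset (Fin m → A)} (h : IsReduced FA b N s.1 s.2)
    (hs : Step FA b s s') : IsReduced FA b N s'.1 s'.2 := by
  classical
  obtain ⟨v, T, i, c, hV, hi, ⟨hc, hvi, -, hvF, -⟩, -, hE', hV'⟩ := hs
  have hvV : v ∈ s.2 := by simp [hV]
  obtain ⟨hvN, hvE⟩ := h.mem v hvV
  have hmem : ∀ w, w ∈ s'.2 ↔ (∃ u ∈ T, elimMap v i c u = w) ∧ w ≠ 0 := by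
    intro w
    simp [hV', elimMap_apply]
  have hN : ∀ u ∈ N, elimMap v i c u ∈ N := fun u hu =>
    N.sub_mem hu (N.smul_mem _ hvN)
  rw [hE'] at *
  refine ⟨fun w hw => ((hmem w).1 hw).2, ?_, ?_, ?_⟩
  · intro w hw
    obtain ⟨⟨u, hu, rfl⟩, -⟩ := (hmem w).1 hw
    obtain ⟨huN, huE⟩ := h.mem u (by simp [hV, hu])
    exact ⟨hN u huN, elimMap_mem_partialFree hc hvi hvE huE⟩
  · intro q x hxq hxN hxE
    have hx0 : x i = 0 := mem_partialFree_iff.1 hxE i (Finset.notMem_erase i _)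
    have hx := h.mem_degSpan q x hxq hxN (partialFree_mono (Finset.erase_subset i _) hxE)
    -- Push the old expression of `x` through `elimMap`: the result expresses `x` itself, because `x
    -- i = 0`, in terms of the new list.
    have hle : degSpan FA b s.2 q ≤
        (degSpan FA b s'.2 q).comap ((elimMap v i c).restrictScalars K) := by
      refine Submodule.span_le.2 ?_
      rintro _ ⟨u, hu, d, p, hud, hpq, f, hf, rfl⟩
      change elimMap v i c (f • u) ∈ degSpan FA b s'.2 q
      rw [map_smul]
      by_cases h0 : elimMap v i c u = 0
      · simp [h0]
      · have huT : u ∈ T := by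
          rw [hV, Multiset.mem_cons] at hu
          refine hu.resolve_left ?_
          rintro rfl
          exact h0 (elimMap_self hc hvi)
        -- The degree of `u` may drop, but the bound `d` persists; this is why `degSpan` uses bounds
        -- instead of exact degrees.
        exact Submodule.subset_span ⟨_, (hmem _).2 ⟨⟨u, huT, rfl⟩, h0⟩, d, p,
          elimMap_mem_freeFil hFA hvF hud, hpq, f, hf, rfl⟩
    have := hle hx
    change elimMap v i c x ∈ degSpan FA b s'.2 q at this
    rwa [elimMap_of_eq_zero hx0] at this
  · intro q x hx
    obtain ⟨y, hyq, hyE, hxy⟩ := h.exists_sub_mem q x hx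
    refine ⟨elimMap v i c y, elimMap_mem_freeFil hFA hvF hyq,
      elimMap_mem_partialFree hc hvi hvE hyE, ?_⟩
    have hxy' : x - elimMap v i c y = (x - y) + (c⁻¹ • y i) • v := by
      rw [elimMap_apply]; abel
    rw [hxy']
    exact N.add_mem hxy (N.smul_mem _ hvN)

lemma IsStandardBasis.isReduced (hFA : IsConnectedFiltration FA) {s : ℕ}
    {ξ : Fin s → Fin m → A} (hU : IsStandardBasis FA (freeFil FA b) N (Set.range ξ)) :
    IsReduced FA b N (initState ξ).1 (initState ξ).2 := by
  obtain ⟨hsub, -, h0, d, hd⟩ := hU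
  have hmem : ∀ v, v ∈ (initState ξ).2 ↔ v ∈ Set.range ξ := by
    intro v; simp [initState]
  have huniv : ∀ x : Fin m → A, x ∈ partialFree A (initState ξ).1 := fun x =>
    mem_partialFree_iff.2 fun i hi => absurd (Finset.mem_univ i) hi
  refine ⟨?_, fun v hv => ⟨hsub ((hmem v).1 hv), huniv v⟩, ?_,
    fun q x hx => ⟨x, hx, huniv x, by simp⟩⟩
  · rintro v hv rfl
    exact h0 ((hmem 0).1 hv)
  · intro q x hxq hxN _
    have hx : (⟨x, hxN⟩ : N) ∈ subFil (freeFil FA b) N q := hxq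
    have hle : subFil (freeFil FA b) N q ≤
        (degSpan FA b (initState ξ).2 q).comap (N.subtype.restrictScalars K) := by
      rw [hd q]
      refine Submodule.span_le.2 ?_
      rintro _ ⟨v, p, hpq, f, hf, rfl⟩
      -- Coefficient `1` with `p = 0` shows that the integer attached to a basis element bounds its
      -- degree.
      have hv : (v : N) ∈ subFil (freeFil FA b) N (d v) := by
        rw [hd]
        exact Submodule.subset_span ⟨v, 0, by simp, 1, hFA.one_mem, by simp⟩
      exact Submodule.subset_span ⟨_, (hmem _).2 v.2, d v, p, hv, hpq, f, hf, rfl⟩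
    exact hle hx

lemma IsReduced.of_reflTransGen (hFA : IsConnectedFiltration FA)
    {s s' : Finset (Fin m) × Multiset (Fin m → A)} (h : IsReduced FA b N s.1 s.2)
    (hs : Relation.ReflTransGen (Step FA b) s s') : IsReduced FA b N s'.1 s'.2 := by
  induction hs with
  | refl => exact h
  | tail _ hstep ih => exact ih.step hFA hstep

lemma Step.card_lt {s s' : Finset (Fin m) × Multiset (Fin m → A)} (h : Step FA b s s') :
    s'.1.card < s.1.card := by
  obtain ⟨v, T, i, c, -, hi, -, -, hE, -⟩ := h
  rw [hE]
  exact Finset.card_erase_lt_of_mem hi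

lemma exists_not_step (run : ℕ → Finset (Fin m) × Multiset (Fin m → A)) :
    ∃ k, ¬ Step FA b (run k) (run (k + 1)) := by
  by_contra! h
  have hk : ∀ k, (run k).1.card + k ≤ (run 0).1.card := by
    intro k
    induction k with
    | zero => simp
    | succ k ih => have := (h k).card_lt; omega
  have := hk ((run 0).1.card + 1)
  omega

lemma exists_reflTransGen_not_step (s : Finset (Fin m) × Multiset (Fin m → A)) :
    ∃ s', Relation.ReflTransGen (Step FA b) s s' ∧ ∀ s'', ¬ Step FA b s' s'' := by
  induction hc : s.1.card using Nat.strong_induction_on generalizing s with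
  | _ k ih =>
    by_cases h : ∃ t, Step FA b s t
    · obtain ⟨t, ht⟩ := h
      obtain ⟨s', hs', hfin⟩ := ih _ (hc ▸ ht.card_lt) t rfl
      exact ⟨s', Relation.ReflTransGen.head ht hs', hfin⟩
    · exact ⟨s, .refl, fun t ht => h ⟨t, ht⟩⟩

/-- A pass needs the least pivot of `v` in `E`; once some pivot exists, finiteness of `E` supplies
the least one. -/
lemma not_isPivot_of_forall_not_step {E : Finset (Fin m)} {V : Multiset (Fin m → A)}
    (hfin : ∀ s', ¬ Step FA b (E, V) s') {v : Fin m → A} (hv : v ∈ V) {i : Fin m}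
    (hi : i ∈ E) (c : K) : ¬ IsPivot FA b v i c := by
  classical
  intro hp
  let P : Finset (Fin m) := E.filter fun k => ∃ c', IsPivot FA b v k c'
  have hP : P.Nonempty := ⟨i, Finset.mem_filter.2 ⟨hi, c, hp⟩⟩
  obtain ⟨hjE, c', hc'⟩ := Finset.mem_filter.1 (P.min'_mem hP)
  obtain ⟨T, hT⟩ := Multiset.exists_cons_of_mem hv
  refine hfin (_, _) ⟨v, T, P.min' hP, c', hT, hjE, hc', ?_, rfl, rfl⟩
  intro k hk hlt c'' hc''
  exact absurd (P.min'_le k (Finset.mem_filter.2 ⟨hk, c'', hc''⟩)) (not_le.2 hlt)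

end Invariant

/-! ### Properties of the output -/

section Output

variable {K A : Type*} [Field K] [Ring A] [Algebra K A] {m : ℕ}
variable {FA : ℕ → Submodule K A} {b : Fin m → ℕ} {N : Submodule A (Fin m → A)}
variable {E : Finset (Fin m)} {V : Multiset (Fin m → A)}

lemma apply_eq_zero_of_mem_freeFil (hFA : IsConnectedFiltration FA) {x : Fin m → A} {q : ℕ}
    {i : Fin m} (hx : x ∈ freeFil FA b q) (hq : q < b i) : x i = 0 := by
  rcases (mem_shiftFil_iff hFA).1 ((mem_freeFil_iff hFA).1 hx i) with h | ⟨p, hp, -⟩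
  · exact h
  · omega

/-- Elements of `N ∩ L_E` of filtered degree at most `b_i` have no term in `e_i`. -/
lemma IsReduced.apply_eq_zero (hFA : IsConnectedFiltration FA) (h : IsReduced FA b N E V)
    (hfin : ∀ s', ¬ Step FA b (E, V) s') {i : Fin m} (hi : i ∈ E) {x : Fin m → A}
    (hx : x ∈ freeFil FA b (b i)) (hxN : x ∈ N) (hxE : x ∈ partialFree A E) : x i = 0 := by
  have hle : degSpan FA b V (b i) ≤
      LinearMap.ker (LinearMap.proj i : (Fin m → A) →ₗ[K] A) := by
    refine Submodule.span_le.2 ?_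
    rintro _ ⟨v, hv, d, p, hvd, hpd, f, hf, rfl⟩
    suffices hvi : v i = 0 by simp [hvi]
    have hvb : v ∈ freeFil FA b (b i) := freeFil_mono hFA (by omega) hvd
    by_contra hne
    rcases (mem_shiftFil_iff hFA).1 ((mem_freeFil_iff hFA).1 hvb i) with h0 | ⟨r, hr, hg⟩
    · exact hne h0
    -- Here `r + b i ≤ b i`, so the coefficient is a constant.
    · obtain rfl : r = 0 := by omega
      obtain ⟨c, hc⟩ := hFA.eq_algebraMap _ hg
      refine not_isPivot_of_forall_not_step hfin hv hi c ⟨?_, hc, h.ne_zero v hv, hvb, ?_⟩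
      · rintro rfl
        exact hne (by simpa using hc)
      -- A degree below `b i` leaves no room for an `e_i`-term, so `v` has degree exactly `b i`.
      · intro q hq hvq
        exact hne (apply_eq_zero_of_mem_freeFil hFA hvq hq)
  exact hle (h.mem_degSpan _ x hx hxN hxE)

lemma degSpan_le_outputSubmodule (h : IsReduced FA b N E V) {q : ℕ} {x : partialFree A E}
    (hx : (x : Fin m → A) ∈ degSpan FA b V q) : x ∈ outputSubmodule E V := by
  have hle : degSpan FA b V q ≤
      ((outputSubmodule E V).map (partialFree A E).subtype).restrictScalars K := by
    refine Submodule.span_le.2 ?_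
    rintro _ ⟨v, hv, d, p, -, -, f, -, rfl⟩
    exact ⟨f • ⟨v, (h.mem v hv).2⟩,
      Submodule.smul_mem _ f (Submodule.subset_span hv), rfl⟩
  obtain ⟨y, hy, hyx⟩ := hle hx
  rwa [← Subtype.ext hyx]

/-- Identifies `N'` with `N ∩ L'`; exhaustiveness provides a degree at which the invariant applies.
-/
lemma IsReduced.mem_outputSubmodule_iff (hFA : IsConnectedFiltration FA)
    (h : IsReduced FA b N E V) {x : partialFree A E} :
    x ∈ outputSubmodule E V ↔ (x : Fin m → A) ∈ N := by
  constructor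
  · intro hx
    have hle : outputSubmodule E V ≤ N.comap (partialFree A E).subtype :=
      Submodule.span_le.2 fun v hv => (h.mem _ hv).1
    exact hle hx
  · intro hx
    obtain ⟨q, hq⟩ := freeFil_exhaustive (b := b) hFA (x : Fin m → A)
    exact degSpan_le_outputSubmodule h (h.mem_degSpan q _ hq hx x.2)

lemma IsReduced.exists_strictFilteredIso (hFA : IsConnectedFiltration FA)
    (h : IsReduced FA b N E V) :
    ∃ φ : (partialFree A E ⧸ outputSubmodule E V) ≃ₗ[A] ((Fin m → A) ⧸ N),
      IsStrictFilteredIso (quotFil (partialFil FA b E) (outputSubmodule E V))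
        (quotFil (freeFil FA b) N) φ := by
  let ψ : partialFree A E →ₗ[A] ((Fin m → A) ⧸ N) := N.mkQ ∘ₗ (partialFree A E).subtype
  have hker : LinearMap.ker ψ = outputSubmodule E V := by
    ext x
    rw [h.mem_outputSubmodule_iff hFA]
    simp [ψ]
  have hsurj : Function.Surjective ψ := by
    intro z
    obtain ⟨x, rfl⟩ := N.mkQ_surjective z
    obtain ⟨q, hq⟩ := freeFil_exhaustive (b := b) hFA x
    obtain ⟨y, -, hyE, hxy⟩ := h.exists_sub_mem q x hq
    exact ⟨⟨y, hyE⟩, ((Submodule.Quotient.eq N).2 hxy).symm⟩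
  let φ := (Submodule.quotEquivOfEq _ _ hker.symm).trans (ψ.quotKerEquivOfSurjective hsurj)
  have hφ : ∀ x, φ ((outputSubmodule E V).mkQ x) = N.mkQ (x : Fin m → A) := fun x => rfl
  refine ⟨φ, fun q => Set.Subset.antisymm ?_ ?_⟩
  · rintro _ ⟨_, ⟨x, hx, rfl⟩, rfl⟩
    exact ⟨x, (mem_partialFil_iff hFA).1 hx, (hφ x).symm⟩
  -- Strictness is the degree control in `exists_sub_mem`: the representative in `L'` costs no
  -- degree.
  · rintro _ ⟨x, hx, rfl⟩
    obtain ⟨y, hyq, hyE, hxy⟩ := h.exists_sub_mem q x hx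
    refine ⟨(outputSubmodule E V).mkQ ⟨y, hyE⟩,
      ⟨⟨y, hyE⟩, (mem_partialFil_iff hFA).2 hyq, rfl⟩, ?_⟩
    rw [hφ]
    exact ((Submodule.Quotient.eq N).2 hxy).symm

lemma finite_outputSet (E : Finset (Fin m)) (V : Multiset (Fin m → A)) :
    (outputSet E V).Finite := by
  classical
  have hV : {v | v ∈ V}.Finite := V.toFinset.finite_toSet.subset fun v hv => by simpa using hv
  exact hV.preimage Subtype.val_injective.injOn

lemma IsReduced.isStandardBasis (hFA : IsConnectedFiltration FA) (h : IsReduced FA b N E V) :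
    IsStandardBasis FA (partialFil FA b E) (outputSubmodule E V) (outputSet E V) := by
  refine ⟨Submodule.subset_span,
    (finite_outputSet E V).preimage Subtype.val_injective.injOn,
    fun h0 => h.ne_zero 0 h0 rfl, ?_⟩
  have hdeg : ∀ v : ((fun x : outputSubmodule E V => (x : partialFree A E)) ⁻¹' outputSet E V),
      ∃ d, HasFilDeg (freeFil FA b) ((v : outputSubmodule E V) : Fin m → A) d := fun v =>
    exists_hasFilDeg hFA (h.ne_zero _ v.2)
  choose d hd using hdeg
  refine ⟨d, fun q => le_antisymm ?_ ?_⟩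
  · intro x hx
    have hxq : ((x : partialFree A E) : Fin m → A) ∈ freeFil FA b q :=
      (mem_partialFil_iff hFA).1 hx
    have hxV := h.mem_degSpan q _ hxq ((h.mem_outputSubmodule_iff hFA).1 x.2) x.1.2
    have hle : degSpan FA b V q ≤ (goodFil FA (fun v : ((fun x : outputSubmodule E V =>
        (x : partialFree A E)) ⁻¹' outputSet E V) => (v : outputSubmodule E V)) d q).map
        (((partialFree A E).subtype ∘ₗ (outputSubmodule E V).subtype).restrictScalars K) := by
      refine Submodule.span_le.2 ?_
      rintro _ ⟨v, hv, k, p, hvk, hpk, f, hf, rfl⟩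
      let w : ((fun x : outputSubmodule E V => (x : partialFree A E)) ⁻¹' outputSet E V) :=
        ⟨⟨⟨v, (h.mem v hv).2⟩, Submodule.subset_span hv⟩, hv⟩
      -- With exact degrees as the attached integers, any bound `k` used in `degSpan` may be
      -- replaced by `d w`.
      have hw : d w ≤ k := (hd w).le_of_mem hvk
      exact ⟨f • (w : outputSubmodule E V),
        Submodule.subset_span ⟨w, p, by omega, f, hf, rfl⟩, rfl⟩
    obtain ⟨y, hy, hyx⟩ := hle hxV
    rwa [← Subtype.ext (Subtype.ext hyx)]
  · refine Submodule.span_le.2 ?_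
    rintro _ ⟨v, p, hp, f, hf, rfl⟩
    exact (mem_partialFil_iff hFA).2 (smul_mem_freeFil hFA hp hf (hd v).2.1)

lemma IsReduced.lt_filDeg [Nontrivial A] (hFA : IsConnectedFiltration FA)
    (h : IsReduced FA b N E V) (hfin : ∀ s', ¬ Step FA b (E, V) s')
    {v : partialFree A E} (hv : v ∈ outputSet E V) {i : Fin m} (hi : i ∈ E) {c : K}
    (hc : c ≠ 0) (hvi : (v : Fin m → A) i = algebraMap K A c) :
    ∃ q, HasFilDeg (partialFil FA b E) v q ∧ b i < q := by
  obtain ⟨q, hq⟩ := exists_hasFilDeg (b := b) hFA (h.ne_zero _ hv)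
  refine ⟨q, ⟨fun h0 => h.ne_zero _ hv (by simp [h0]), (mem_partialFil_iff hFA).2 hq.2.1,
    fun p hp hvp => hq.2.2 p hp ((mem_partialFil_iff hFA).1 hvp)⟩, ?_⟩
  have hne : (v : Fin m → A) i ≠ 0 := by
    rw [hvi]
    exact (map_ne_zero_iff _ (algebraMap K A).injective).2 hc
  rcases lt_trichotomy (b i) q with hlt | heq | hgt
  · exact hlt
  · exact absurd ⟨hc, hvi, heq ▸ hq⟩ (not_isPivot_of_forall_not_step hfin hv hi c)
  · exact absurd (apply_eq_zero_of_mem_freeFil hFA hq.2.1 hgt) hne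

/-- The coset of `e_i` is not congruent to an element of `L_E` of filtered degree at most `b_i`
without a term in `e_i`. -/
lemma IsReduced.mkQ_e_ne [Nontrivial A] (hFA : IsConnectedFiltration FA)
    (h : IsReduced FA b N E V) (hfin : ∀ s', ¬ Step FA b (E, V) s') {i : Fin m} (hi : i ∈ E)
    {y : Fin m → A} (hy : y ∈ freeFil FA b (b i)) (hyE : y ∈ partialFree A E) (hyi : y i = 0) :
    N.mkQ (e A i) ≠ N.mkQ y := by
  intro heq
  have h0 := h.apply_eq_zero hFA hfin hi (sub_mem (e_mem_freeFil hFA le_rfl) hy)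
    ((Submodule.Quotient.eq N).1 heq) (sub_mem (e_mem_partialFree hi) hyE)
  simp [e, hyi] at h0

/-- A representative of degree below `b i` could be moved into `L_E`, where it would have no
`e_i`-term. -/
lemma IsReduced.mkQ_e_notMem_quotFil [Nontrivial A] (hFA : IsConnectedFiltration FA)
    (h : IsReduced FA b N E V) (hfin : ∀ s', ¬ Step FA b (E, V) s') {i : Fin m} (hi : i ∈ E)
    {q : ℕ} (hq : q < b i) : N.mkQ (e A i) ∉ quotFil (freeFil FA b) N q := by
  rintro ⟨x, hx, hxe⟩
  obtain ⟨y, hyq, hyE, hxy⟩ := h.exists_sub_mem q x hx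
  refine h.mkQ_e_ne hFA hfin hi (freeFil_mono hFA hq.le hyq) hyE
    (apply_eq_zero_of_mem_freeFil hFA hyq hq) ?_
  rw [← hxe]
  exact (Submodule.Quotient.eq N).2 hxy

lemma IsReduced.injOn_mkQ_e [Nontrivial A] (hFA : IsConnectedFiltration FA)
    (h : IsReduced FA b N E V) (hfin : ∀ s', ¬ Step FA b (E, V) s') :
    Set.InjOn (fun i => N.mkQ (e A i)) (E : Set (Fin m)) := by
  -- The index with the larger `b` must play the role of `i`, so that `e_j` has degree at most `b
  -- i`.
  have key : ∀ i ∈ E, ∀ j ∈ E, b j ≤ b i → N.mkQ (e A i) = N.mkQ (e A j) → i = j := by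
    intro i hi j hj hle heq
    by_contra hne
    exact h.mkQ_e_ne hFA hfin hi (e_mem_freeFil hFA hle) (e_mem_partialFree hj)
      (by simp [e, hne]) heq
  intro i hi j hj heq
  rcases le_total (b j) (b i) with hle | hle
  · exact key i hi j hj hle heq
  · exact (key j hj i hi hle heq.symm).symm

lemma IsReduced.isFBasis_mkQ_e [Nontrivial A] (hFA : IsConnectedFiltration FA)
    (h : IsReduced FA b N E V) (hfin : ∀ s', ¬ Step FA b (E, V) s') :
    IsFBasis FA (quotFil (freeFil FA b) N)
      ((fun i => N.mkQ (e A i)) '' (E : Set (Fin m))) := by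
  refine ⟨(E.finite_toSet).image _, ?_, ?_⟩
  · rintro ⟨i, hi, h0⟩
    exact h.mkQ_e_ne hFA hfin hi (zero_mem _) (zero_mem _) rfl
      (h0.trans (map_zero N.mkQ).symm)
  choose idx hidxE hidx using fun w : ((fun i => N.mkQ (e A i)) '' (E : Set (Fin m))) => w.2
  refine ⟨fun w => b (idx w), fun q => le_antisymm ?_ ?_⟩
  · rintro _ ⟨x, hx, rfl⟩
    obtain ⟨y, hyq, hyE, hxy⟩ := h.exists_sub_mem q x hx
    have hle : partialFil FA b E q ≤ (goodFil FA
        (fun w : ((fun i => N.mkQ (e A i)) '' (E : Set (Fin m))) => (w : (Fin m → A) ⧸ N))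
        (fun w => b (idx w)) q).comap
        ((N.mkQ ∘ₗ (partialFree A E).subtype).restrictScalars K) := by
      refine Submodule.span_le.2 ?_
      rintro _ ⟨i, p, hp, f, hf, rfl⟩
      let w : ((fun i => N.mkQ (e A i)) '' (E : Set (Fin m))) :=
        ⟨N.mkQ (e A (i : Fin m)), i, i.2, rfl⟩
      -- Distinctness of the cosets makes the chosen index, hence the attached degree, the right
      -- one.
      have hw : idx w = i := h.injOn_mkQ_e hFA hfin (hidxE w) i.2 (hidx w)
      exact Submodule.subset_span ⟨w, p, by simpa only [hw] using hp, f, hf, rfl⟩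
    have hy := hle ((mem_partialFil_iff hFA (x := ⟨y, hyE⟩)).2 hyq)
    change N.mkQ x ∈ _
    rw [show N.mkQ x = N.mkQ y from (Submodule.Quotient.eq N).2 hxy]
    exact hy
  · refine Submodule.span_le.2 ?_
    rintro _ ⟨w, p, hp, f, hf, rfl⟩
    refine ⟨f • e A (idx w), smul_e_mem_freeFil hp hf, ?_⟩
    change N.mkQ (f • e A (idx w)) = _
    exact (map_smul _ _ _).trans (congrArg (f • ·) (hidx w))

lemma IsReduced.isMinimalFBasis_mkQ_e [Nontrivial A] (hFA : IsConnectedFiltration FA)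
    (h : IsReduced FA b N E V) (hfin : ∀ s', ¬ Step FA b (E, V) s') :
    IsMinimalFBasis FA (quotFil (freeFil FA b) N)
      ((fun i => N.mkQ (e A i)) '' (E : Set (Fin m))) := by
  refine ⟨h.isFBasis_mkQ_e hFA hfin, ?_⟩
  rintro W hW ⟨-, -, d, hd⟩
  obtain ⟨_, ⟨i, hi, rfl⟩, hiW⟩ := Set.exists_of_ssubset hW
  have hmem : N.mkQ (e A i) ∈ quotFil (freeFil FA b) N (b i) :=
    ⟨e A i, e_mem_freeFil hFA le_rfl, rfl⟩
  -- If `W` omits the coset of `e_i`, its expressions lift to `L_{E \ {i}}` without raising degree;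
  -- applied to that coset, this contradicts `mkQ_e_ne`.
  have hle : quotFil (freeFil FA b) N (b i) ≤
      (freeFil FA b (b i) ⊓ (partialFree A (E.erase i)).restrictScalars K).map
        (N.mkQ.restrictScalars K) := by
    rw [hd (b i)]
    refine Submodule.span_le.2 ?_
    rintro _ ⟨w, p, hp, f, hf, rfl⟩
    obtain ⟨j, hj, hjw⟩ := hW.1 w.2
    have hji : j ≠ i := by
      rintro rfl
      exact hiW (by rw [hjw]; exact w.2)
    have hwd : (w : (Fin m → A) ⧸ N) ∈ quotFil (freeFil FA b) N (d w) := by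
      rw [hd]
      exact Submodule.subset_span ⟨w, 0, by simp, 1, hFA.one_mem, by simp⟩
    -- The integers attached to `W` are arbitrary, but cannot be smaller than the degree `b j` of
    -- the coset of `e_j`.
    have hbj : b j ≤ d w := by
      by_contra hlt
      refine h.mkQ_e_notMem_quotFil hFA hfin hj (not_le.1 hlt) ?_
      rw [← hjw] at hwd
      exact hwd
    refine ⟨f • e A j, ⟨smul_e_mem_freeFil (p := p) (by omega) hf,
      Submodule.smul_mem _ _ (e_mem_partialFree (Finset.mem_erase.2 ⟨hji, hj⟩))⟩, ?_⟩
    change N.mkQ (f • e A j) = _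
    exact (map_smul _ _ _).trans (congrArg (f • ·) hjw)
  obtain ⟨y, ⟨hyq, hyE⟩, hye⟩ := hle hmem
  exact h.mkQ_e_ne hFA hfin hi hyq (partialFree_mono (Finset.erase_subset i E) hyE)
    (mem_partialFree_iff.1 hyE i (Finset.notMem_erase i E)) hye.symm

end Output

end FilteredSolvable

open FilteredSolvable in
theorem proposition5p3 {K A : Type*} [Field K] [Ring A] [Algebra K A] {n : ℕ}
    (S : WeightedFilteredSolvableAlgebra K A n) {m s : ℕ} (b : Fin m → ℕ)
    (N : Submodule A (Fin m → A)) (ξ : Fin s → Fin m → A)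
    (hU : IsStandardBasis S.fil (freeFil S.fil b) N (Set.range ξ)) :
    -- every run stops, and there is an output
    (∀ run : ℕ → Finset (Fin m) × Multiset (Fin m → A), run 0 = initState ξ →
      ∃ k, ¬ Step S.fil b (run k) (run (k + 1))) ∧
    (∃ E V, IsOutput S.fil b ξ E V) ∧
    -- every output has the stated properties
    ∀ (E : Finset (Fin m)) (V : Multiset (Fin m → A)), IsOutput S.fil b ξ E V →
      -- `V ⊆ N ∩ L'`
      (∀ v ∈ V, v ∈ N ∧ v ∈ partialFree A E) ∧
      -- (i) a strict filtered isomorphism `L'/N' ≅ L/N`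
      (∃ φ : (partialFree A E ⧸ outputSubmodule E V) ≃ₗ[A] ((Fin m → A) ⧸ N),
        IsStrictFilteredIso (quotFil (partialFil S.fil b E) (outputSubmodule E V))
          (quotFil (freeFil S.fil b) N) φ) ∧
      -- (ii) `V` is a standard basis of `N'` without constant coefficients in top degree
      IsStandardBasis S.fil (partialFil S.fil b E) (outputSubmodule E V) (outputSet E V) ∧
      (∀ v ∈ outputSet E V, ∀ i ∈ E, ∀ c : K, c ≠ 0 →
        (v : Fin m → A) i = algebraMap K A c →
        ∃ q, HasFilDeg (partialFil S.fil b E) v q ∧ b i < q) ∧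
      -- (iii) the cosets of the remaining `e_i` are distinct and form a minimal F-basis
      Set.InjOn (fun i => N.mkQ (e A i)) (E : Set (Fin m)) ∧
      IsMinimalFBasis S.fil (quotFil (freeFil S.fil b) N)
        ((fun i => N.mkQ (e A i)) '' (E : Set (Fin m))) := by
  have hFA := S.isConnectedFiltration
  have : Nontrivial A := S.nontrivial
  refine ⟨fun run _ => exists_not_step run, ?_, ?_⟩
  · obtain ⟨⟨E, V⟩, hr, hfin⟩ := exists_reflTransGen_not_step (FA := S.fil) (b := b) (initState ξ)
    exact ⟨E, V, hr, hfin⟩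
  · rintro E V ⟨hr, hfin⟩
    have h : IsReduced S.fil b N E V := (hU.isReduced hFA).of_reflTransGen hFA hr
    exact ⟨h.mem, h.exists_strictFilteredIso hFA, h.isStandardBasis hFA,
      fun v hv i hi c hc hvi => h.lt_filDeg hFA hfin hv hi hc hvi,
      h.injOn_mkQ_e hFA hfin, h.isMinimalFBasis_mkQ_e hFA hfin⟩
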